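/- **Setting.** Let $D\subset\mathbb C^4$ be open, with coordinates $(w,z,x,y)$ and connected (or empty) fibres over $(w,z)$, and let $\Theta$ be a holomorphic solution on $D$ of the second heavenly equation $\Theta_{xw}+\Theta_{yz}+\Theta_{xx}\Theta_{yy}-\Theta_{xy}^2=0$. Write $w^A=(w,z)$, $x^A=(y,-x)$, $\partial/\partial w_A=(-\partial_z,\partial_w)$, $x_A\,\partial/\partial w_A=y\partial_w-x\partial_z$, and $$\nabla_{00'}=\partial_y,\quad \nabla_{10'}=-\partial_x,\quad \nabla_{01'}=\partial_w-\Theta_{xy}\partial_y+\Theta_{yy}\partial_x,\quad \nabla_{11'}=\partial_z+\Theta_{xx}\partial_y-\Theta_{xy}\partial_x .$$ Let $\mathcal W_g$ be the space of holomorphic solutions on $D$ of $\phi_{xw}+\phi_{yz}+\Theta_{yy}\phi_{xx}+\Theta_{xx}\phi_{yy}-2\Theta_{xy}\phi_{xy}=0$ (the linearised equation). The recursion operator is the relation $\psi=R\phi$ given by $\nabla_{A1'}\phi=\nabla_{A0'}\psi$, $A=0,1$; it determines $\psi$ up to functions of $(w,z)$. *Residual fields.* For holomorphic functions $h,g$ of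 $(w,z)$ put $$M=\frac{\partial h}{\partial w_A}\frac{\partial}{\partial w^A}+\Big(\frac{\partial g}{\partial w_A}+x^B\frac{\partial^2h}{\partial w_A\partial w^B}\Big)\frac{\partial}{\partial x^A}.$$ A *pure gauge element* for $M$ is a function of the form $$F+x_AG^A+\tfrac12x_Ax_B\frac{\partial^2g}{\partial w_A\partial w_B}+\tfrac16x_Ax_Bx_C\frac{\partial^3h}{\partial w_A\partial w_B\partial w_C}+M(\Theta),$$ with $F,G^A$ holomorphic functions of $(w,z)$ only. *Twistor functions.* A twistor function is a holomorphic function $f(w,z,x,y,\lambda)$ with $\nabla_{A0'}f=\lambda\nabla_{A1'}f$, $A=0,1$ (it represents an $\mathcal O(2)$-valued function on twistor space, in the trivialisation $\pi_{1'}=1$, $\lambda=\pi_{0'}/\pi_{1'}$). The canonical Poisson bracket on the fibres $\lambda=\mathrm{const}$ is $\{f,k\}=\nabla_{01'}f\,\nabla_{11'}k-\nabla_{11'}f\,\nabla_{01'}k$. A *generator* of $M$ is a twistor function $f_M$ on $D\times\{|\lambda|<r\}$ with $f_M=h+\lambda\big(g+x^A\,\partial h/\partial w^A\big)+O(\lambda^2)$.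 Fix $0<\rho<r$. For $i\in\mathbb Z$ put $\delta_M^if=\lambda^{-i}f_M$ and $$\delta_M^i\Theta=\frac1{2\pi i}\oint_{|\lambda|=\rho}\frac{\delta_M^if}{\lambda^4}\,d\lambda,\qquad [\delta_M^i,\delta_N^j]\Theta=\frac1{2\pi i}\oint_{|\lambda|=\rho}\frac{\{\delta_M^if,\delta_N^jf\}}{\lambda^4}\,d\lambda .$$ **Proposition.** Let $M,N$ be two such fields (with data $h_M,g_M$ and $h_N,g_N$) and let $f_M,f_N$ be generators of them. 1. $M$ preserves the volume form $dw\wedge dz\wedge dx\wedge dy$ and the two-forms $dw\wedge dz$ and $dx\wedge dw+dy\wedge dz$; $\delta_M^0\Theta$ is a pure gauge element for $M$; and for all $i\in\mathbb Z$, $\delta_M^i\Theta\in\mathcal W_g$ and $\delta_M^{i+1}\Theta=R\,\delta_M^i\Theta$, so that $\delta^i_M\Theta=R^i\delta_M\Theta$. The same holds for $N$. 2. The Lie bracket $[M,N]$ is on $D$ again a field of the above form, for suitable $h,g$, and has a generator $f_{[M,N]}$ on $D\times\{|\lambda|<r\}$ (so that 1 holds for it as well) such that, for all $i,j\in\mathbb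 Z$, $$[\delta_M^i,\delta_N^j]\Theta=\delta_{[M,N]}^{i+j}\Theta\quad\text{on } D .$$ -/

import Mathlib

namespace Heavenly

/-- Points `(w, z, x, y)` of complexified space-time, in the coordinates of the second heavenly
equation; in spinor notation `w^A = (w, z)` and `x^A = (y, -x)`. -/
abbrev Spacetime := Fin 4 → ℂ

/-- Points `(w, z)` of the two-dimensional base. -/
abbrev Base := Fin 2 → ℂ

/-- The projection `(w, z, x, y) ↦ (w, z)`. -/
def toBase (p : Spacetime) : Base := ![p 0, p 1]

/-- The holomorphic partial derivative in the `k`-th coordinate. On `Spacetime`, `pd 0`, `pd 1`,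
`pd 2`, `pd 3` are `∂_w`, `∂_z`, `∂_x`, `∂_y`; on `Base`, `pd 0`, `pd 1` are `∂_w`, `∂_z`. -/
noncomputable def pd {n : ℕ} (k : Fin n) (φ : (Fin n → ℂ) → ℂ) (p : Fin n → ℂ) : ℂ :=
  fderiv ℂ φ p (Pi.single k 1)

/-- The second heavenly equation `Θ_xw + Θ_yz + Θ_xx Θ_yy - Θ_xy² = 0` on `D`. -/
def IsHeavenly (D : Set Spacetime) (Θ : Spacetime → ℂ) : Prop :=
  ∀ p ∈ D, pd 0 (pd 2 Θ) p + pd 1 (pd 3 Θ) p + pd 2 (pd 2 Θ) p * pd 3 (pd 3 Θ) p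
    - (pd 2 (pd 3 Θ) p) ^ 2 = 0

/-! The null tetrad `∇_{AA'}` determined by `Θ`. -/

/-- `∇_{00'} = ∂_y`. -/
noncomputable def nabla00 (φ : Spacetime → ℂ) (p : Spacetime) : ℂ := pd 3 φ p

/-- `∇_{10'} = -∂_x`. -/
noncomputable def nabla10 (φ : Spacetime → ℂ) (p : Spacetime) : ℂ := -pd 2 φ p

/-- `∇_{01'} = ∂_w - Θ_xy ∂_y + Θ_yy ∂_x`. -/
noncomputable def nabla01 (Θ φ : Spacetime → ℂ) (p : Spacetime) : ℂ :=
  pd 0 φ p - pd 2 (pd 3 Θ) p * pd 3 φ p + pd 3 (pd 3 Θ) p * pd 2 φ p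

/-- `∇_{11'} = ∂_z + Θ_xx ∂_y - Θ_xy ∂_x`. -/
noncomputable def nabla11 (Θ φ : Spacetime → ℂ) (p : Spacetime) : ℂ :=
  pd 1 φ p + pd 2 (pd 2 Θ) p * pd 3 φ p - pd 2 (pd 3 Θ) p * pd 2 φ p

/-- The space `W_g` of holomorphic solutions on `D` of the wave equation of the metric determined
by `Θ` (equivalently, of the linearised second heavenly equation):
`φ_xw + φ_yz + Θ_yy φ_xx + Θ_xx φ_yy - 2 Θ_xy φ_xy = 0`. -/
structure IsWave (D : Set Spacetime) (Θ φ : Spacetime → ℂ) : Prop where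
  holomorphic : AnalyticOnNhd ℂ φ D
  wave : ∀ p ∈ D, pd 0 (pd 2 φ) p + pd 1 (pd 3 φ) p + pd 3 (pd 3 Θ) p * pd 2 (pd 2 φ) p
    + pd 2 (pd 2 Θ) p * pd 3 (pd 3 φ) p - 2 * pd 2 (pd 3 Θ) p * pd 2 (pd 3 φ) p = 0

/-- `ψ = R φ` for the recursion operator: `∇_{A1'} φ = ∇_{A0'} ψ` for `A = 0, 1`. Only a relation,
as `ψ` is determined by `φ` up to adding functions of `(w, z)`. -/
def IsRecursion (D : Set Spacetime) (Θ φ ψ : Spacetime → ℂ) : Prop :=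
  ∀ p ∈ D, nabla00 ψ p = nabla01 Θ φ p ∧ nabla10 ψ p = nabla11 Θ φ p

/-! Residual vector fields. -/

/-- The (constant coefficient) two-form `dw ∧ dz`. -/
def sigma11 (u v : Spacetime) : ℂ := u 0 * v 1 - u 1 * v 0

/-- The (constant coefficient) two-form `dx ∧ dw + dy ∧ dz = dx_A ∧ dw^A`. -/
def sigma01 (u v : Spacetime) : ℂ := (u 2 * v 0 - u 0 * v 2) + (u 3 * v 1 - u 1 * v 3)

/-- The Lie derivative along `M` of a two-form `σ` with constant coefficients, at `p`. -/
noncomputable def lieDerivConst (σ : Spacetime → Spacetime → ℂ) (M : Spacetime → Spacetime)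
    (p u v : Spacetime) : ℂ :=
  σ (fderiv ℂ M p u) v + σ u (fderiv ℂ M p v)

/-- Residual symmetries of the second form: holomorphic vector fields that preserve the volume form
`dw ∧ dz ∧ dx ∧ dy` and the self-dual two-forms `dw ∧ dz` and `dx_A ∧ dw^A`. -/
structure IsResidual (D : Set Spacetime) (M : Spacetime → Spacetime) : Prop where
  holomorphic : AnalyticOnNhd ℂ M D
  volume : ∀ p ∈ D, ∑ k, pd k (fun q => M q k) p = 0
  preserves11 : ∀ p ∈ D, ∀ u v, lieDerivConst sigma11 M p u v = 0
  preserves01 : ∀ p ∈ D, ∀ u v, lieDerivConst sigma01 M p u v = 0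

/-- The residual vector field
`M = ∂h/∂w_A ∂/∂w^A + (∂g/∂w_A + x^B ∂²h/∂w_A∂w^B) ∂/∂x^A` with `h`, `g` functions of `(w, z)`, where
`∂/∂w_A = (-∂_z, ∂_w)` and `∂/∂x^A = (∂_y, -∂_x)`; its components are `(M^w, M^z, M^x, M^y)`. -/
noncomputable def residualField (h g : Base → ℂ) (p : Spacetime) : Spacetime :=
  ![-pd 1 h (toBase p),
    pd 0 h (toBase p),
    -(pd 0 g (toBase p) + p 3 * pd 0 (pd 0 h) (toBase p) - p 2 * pd 0 (pd 1 h) (toBase p)),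
    -(pd 1 g (toBase p) + p 3 * pd 0 (pd 1 h) (toBase p) - p 2 * pd 1 (pd 1 h) (toBase p))]

/-- `φ` is a pure gauge element `δ_M Θ` for the residual field `M = residualField h g`:
`φ = F + x_A G^A + ½ x_A x_B ∂²g/∂w_A∂w_B + ⅙ x_A x_B x_C ∂³h/∂w_A∂w_B∂w_C + M(Θ)` with functions
`F`, `G^A` of `(w, z)` only; note `x_A ∂/∂w_A = y ∂_w - x ∂_z`. -/
def IsPureGauge (D : Set Spacetime) (Θ : Spacetime → ℂ) (h g : Base → ℂ)
    (φ : Spacetime → ℂ) : Prop :=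
  ∃ F G₀ G₁ : Base → ℂ,
    AnalyticOnNhd ℂ F (toBase '' D) ∧ AnalyticOnNhd ℂ G₀ (toBase '' D) ∧
    AnalyticOnNhd ℂ G₁ (toBase '' D) ∧
    ∀ p ∈ D, φ p = F (toBase p) + (p 2 * G₀ (toBase p) + p 3 * G₁ (toBase p))
      + 1 / 2 * (p 3 ^ 2 * pd 0 (pd 0 g) (toBase p)
        - 2 * p 2 * p 3 * pd 0 (pd 1 g) (toBase p)
        + p 2 ^ 2 * pd 1 (pd 1 g) (toBase p))
      + 1 / 6 * (p 3 ^ 3 * pd 0 (pd 0 (pd 0 h)) (toBase p)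
        - 3 * p 2 * p 3 ^ 2 * pd 0 (pd 0 (pd 1 h)) (toBase p)
        + 3 * p 2 ^ 2 * p 3 * pd 0 (pd 1 (pd 1 h)) (toBase p)
        - p 2 ^ 3 * pd 1 (pd 1 (pd 1 h)) (toBase p))
      + fderiv ℂ Θ p (residualField h g p)

/-! Twistor functions, in the affine fibre coordinate `λ = π_{0'}/π_{1'}` of the spin bundle.
Sections of `O(2)` are written in the trivialisation `π_{1'} = 1`. -/

/-- Holomorphic functions on `D × Λ` that descend to twistor space: they are annihilated by the Lax
pair `L_A = ∇_{A0'} - λ ∇_{A1'}`, `A = 0, 1`. -/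
structure IsTwistorFunction (D : Set Spacetime) (Θ : Spacetime → ℂ) (Λ : Set ℂ)
    (f : Spacetime × ℂ → ℂ) : Prop where
  holomorphic : AnalyticOnNhd ℂ f (D ×ˢ Λ)
  lax0 : ∀ p ∈ D, ∀ l ∈ Λ,
    nabla00 (fun q => f (q, l)) p - l * nabla01 Θ (fun q => f (q, l)) p = 0
  lax1 : ∀ p ∈ D, ∀ l ∈ Λ,
    nabla10 (fun q => f (q, l)) p - l * nabla11 Θ (fun q => f (q, l)) p = 0

/-- The canonical Poisson bracket on the fibres `λ = const` of twistor space, pulled back to the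
spin bundle: `{f, k} = ∇_{01'} f ∇_{11'} k - ∇_{11'} f ∇_{01'} k`; see `poisson_spec`. -/
noncomputable def poisson (Θ : Spacetime → ℂ) (f k : Spacetime × ℂ → ℂ) (q : Spacetime × ℂ) : ℂ :=
  nabla01 Θ (fun p => f (p, q.2)) q.1 * nabla11 Θ (fun p => k (p, q.2)) q.1
    - nabla11 Θ (fun p => f (p, q.2)) q.1 * nabla01 Θ (fun p => k (p, q.2)) q.1

/-- The one-form `e^0 = e^{01'} + λ e^{00'} = dw + λ (dy + Θ_xy dw - Θ_xx dz)`. -/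
noncomputable def coframe0 (Θ : Spacetime → ℂ) (p : Spacetime) (l : ℂ) (u : Spacetime) : ℂ :=
  u 0 + l * (u 3 + pd 2 (pd 3 Θ) p * u 0 - pd 2 (pd 2 Θ) p * u 1)

/-- The one-form `e^1 = e^{11'} + λ e^{10'} = dz + λ (-dx + Θ_yy dw - Θ_xy dz)`. -/
noncomputable def coframe1 (Θ : Spacetime → ℂ) (p : Spacetime) (l : ℂ) (u : Spacetime) : ℂ :=
  u 1 + l * (-u 2 + pd 3 (pd 3 Θ) p * u 0 - pd 2 (pd 3 Θ) p * u 1)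

theorem fderiv_eq_pd (φ : Spacetime → ℂ) (p u : Spacetime) :
    fderiv ℂ φ p u = u 0 * pd 0 φ p + u 1 * pd 1 φ p + u 2 * pd 2 φ p + u 3 * pd 3 φ p := by
  have hu : u = u 0 • Pi.single 0 1 + u 1 • Pi.single 1 1 + u 2 • Pi.single 2 1
      + u 3 • (Pi.single 3 1 : Spacetime) := by
    ext k
    fin_cases k <;> simp
  conv_lhs => rw [hu]
  simp only [map_add, map_smul, smul_eq_mul, pd]

/-- `poisson` is the Poisson bracket of the symplectic form `Σ(λ) = e^0 ∧ e^1` that descends to the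
fibres of twistor space: `df ∧ dk = {f, k} Σ(λ)` for twistor functions `f`, `k`. -/
theorem poisson_spec {D : Set Spacetime} {Θ : Spacetime → ℂ} {Λ : Set ℂ} {f k : Spacetime × ℂ → ℂ}
    (hf : IsTwistorFunction D Θ Λ f) (hk : IsTwistorFunction D Θ Λ k)
    {p : Spacetime} (hp : p ∈ D) {l : ℂ} (hl : l ∈ Λ) (u v : Spacetime) :
    fderiv ℂ (fun q => f (q, l)) p u * fderiv ℂ (fun q => k (q, l)) p v
      - fderiv ℂ (fun q => f (q, l)) p v * fderiv ℂ (fun q => k (q, l)) p u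
    = poisson Θ f k (p, l) *
      (coframe0 Θ p l u * coframe1 Θ p l v - coframe0 Θ p l v * coframe1 Θ p l u) := by
  have key : ∀ f : Spacetime × ℂ → ℂ, IsTwistorFunction D Θ Λ f → ∀ u : Spacetime,
      fderiv ℂ (fun q => f (q, l)) p u =
        nabla01 Θ (fun q => f (q, l)) p * coframe0 Θ p l u
          + nabla11 Θ (fun q => f (q, l)) p * coframe1 Θ p l u := by
    intro f hf u
    have h0 := hf.lax0 p hp l hl
    have h1 := hf.lax1 p hp l hl
    rw [fderiv_eq_pd]
    simp only [nabla00, nabla10, nabla01, nabla11, coframe0, coframe1] at *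
    linear_combination
      (u 3 + pd 2 (pd 3 Θ) p * u 0 - pd 2 (pd 2 Θ) p * u 1) * h0
        + (-u 2 + pd 3 (pd 3 Θ) p * u 0 - pd 2 (pd 3 Θ) p * u 1) * h1
  rw [key f hf, key f hf, key k hk, key k hk]
  simp only [poisson]
  ring

/-- `f` is the Hamiltonian, holomorphic over the part `|λ| < r` of twistor space, of an infinitesimal
symplectic symmetry whose residual vector field is `residualField h g`: it is a twistor function and
`f = h + λ (g + x^A ∂h/∂w^A) + O(λ²)`. -/
structure IsGenerator (D : Set Spacetime) (Θ : Spacetime → ℂ) (r : ℝ) (h g : Base → ℂ)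
    (f : Spacetime × ℂ → ℂ) : Prop where
  holomorphic_h : AnalyticOnNhd ℂ h (toBase '' D)
  holomorphic_g : AnalyticOnNhd ℂ g (toBase '' D)
  twistor : IsTwistorFunction D Θ (Metric.ball 0 r) f
  order_zero : ∀ p ∈ D, f (p, 0) = h (toBase p)
  order_one : ∀ p ∈ D, deriv (fun l => f (p, l)) 0
    = g (toBase p) + p 3 * pd 0 h (toBase p) - p 2 * pd 1 h (toBase p)

/-- The linearised solution of the second heavenly equation that corresponds to an `O(2)`-valued
twistor function: `δΘ = (1/2πi) ∮ f / (π_{0'})⁴ π·dπ = (1/2πi) ∮ f λ⁻⁴ dλ` over `|λ| = ρ`. -/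
noncomputable def contour (ρ : ℝ) (f : Spacetime × ℂ → ℂ) (p : Spacetime) : ℂ :=
  (2 * (Real.pi : ℂ) * Complex.I)⁻¹ * ∮ l in C(0, ρ), f (p, l) / l ^ 4

/-- The action of the `i`-th power of the recursion operator on twistor functions, `f ↦ λ^{-i} f`. -/
noncomputable def twist (i : ℤ) (f : Spacetime × ℂ → ℂ) (q : Spacetime × ℂ) : ℂ :=
  q.2 ^ (-i) * f q

/-- The hidden symmetries `δ_M^i Θ` obtained from the twistor function `f` of `δ_M Θ`. -/
noncomputable def hidden (ρ : ℝ) (f : Spacetime × ℂ → ℂ) (i : ℤ) : Spacetime → ℂ :=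
  contour ρ (twist i f)

/-- The bracket `[δ_M^i, δ_N^j] Θ = (1/2πi) ∮ {δ_M^i f, δ_N^j f} / (π_{0'})⁴ π·dπ`. -/
noncomputable def hiddenBracket (ρ : ℝ) (Θ : Spacetime → ℂ) (f k : Spacetime × ℂ → ℂ) (i j : ℤ) :
    Spacetime → ℂ :=
  contour ρ (poisson Θ (twist i f) (twist j k))

/-- `φ i = R^i δ_M Θ` in `W_g` for all `i`, where `M = residualField h g` is a residual symmetry and
`δ_M Θ = φ 0` is a pure gauge element for `M`. -/
structure IsHiddenTower (D : Set Spacetime) (Θ : Spacetime → ℂ) (h g : Base → ℂ)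
    (φ : ℤ → Spacetime → ℂ) : Prop where
  residual : IsResidual D (residualField h g)
  gauge : IsPureGauge D Θ h g (φ 0)
  wave : ∀ i, IsWave D Θ (φ i)
  recursion : ∀ i, IsRecursion D Θ (φ i) (φ (i + 1))

end Heavenly

open Heavenly

/-!
The integral `δ_M^i Θ` over `|λ| = ρ` is the coefficient of `λ^(i+3)` in the Taylor expansion of the
generator `f_M`, and zero for `i < -3` (`hidden_eq_taylor`, `hidden_eq_zero`). It is therefore
holomorphic, and space-time derivatives pass under the integral (`pd_hidden`). The Lax pair
`∇_{A0'} f = λ ∇_{A1'} f`, integrated against a power of `λ`, becomes the recursion relation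
between consecutive coefficients (`IsTwistorFunction.isRecursion_hidden`), and the wave equation is
the integrability condition `ψ_xy = ψ_yx` of a recursion relation `ψ = R φ` (`IsRecursion.isWave`).

The recursion relation prescribes `∂_x ψ` and `∂_y ψ`, so that, the fibres over `(w, z)` being
connected, it determines `ψ` up to a function of `(w, z)` (`IsRecursion.exists_eq_add`). The
expansion of `f_M` starts with `h + λ (g + x^A ∂h/∂w^A)`; two explicit integrations give the
coefficient of `λ³`, which is the pure gauge form of `δ_M Θ` (`IsGenerator.isPureGauge`). Only the
second of them uses the heavenly equation for `Θ`.

The generator of `[M, N]` is the Poisson bracket `{f_M, f_N}`. It is the determinant of the vectors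
`(∇_{01'} f, ∇_{11'} f)` of the two functions, and on solutions of the Lax equations the operators
`∇_{A0'} - λ ∇_{A1'}` act on such a vector by trace-free matrices (`lax_nabla`); hence the bracket
is again a twistor function. Its expansion to first order in `λ` is given by the Poisson brackets of
the jets `h + λ g` (`IsGenerator.poisson`), and so is the Lie bracket of residual fields
(`residualField_basePoisson`). Since powers of `λ` are constants for the Poisson bracket, the
brackets of the hidden symmetries follow (`hiddenBracket_eq_hidden`).
-/

open Heavenly

namespace Heavenly

/-! ### Partial derivatives of holomorphic functions -/

section PartialDerivatives

variable {n : ℕ} {k : Fin n} {φ ψ : (Fin n → ℂ) → ℂ} {p : Fin n → ℂ}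

@[fun_prop]
theorem AnalyticAt.pd (hφ : AnalyticAt ℂ φ p) : AnalyticAt ℂ (pd k φ) p :=
  (ContinuousLinearMap.apply ℂ ℂ (Pi.single k (1 : ℂ) : Fin n → ℂ)).analyticAt _
    |>.fun_comp hφ.fderiv

theorem pd_congr (h : φ =ᶠ[nhds p] ψ) : pd k φ p = pd k ψ p := by
  simp only [pd, h.fderiv_eq]

theorem pd_eq_of_eqOn {U : Set (Fin n → ℂ)} (hU : IsOpen U) (h : Set.EqOn φ ψ U) (hp : p ∈ U) :
    pd k φ p = pd k ψ p :=
  pd_congr (h.eventuallyEq_of_mem (hU.mem_nhds hp))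

theorem pd_add (hφ : AnalyticAt ℂ φ p) (hψ : AnalyticAt ℂ ψ p) :
    pd k (fun q => φ q + ψ q) p = pd k φ p + pd k ψ p := by
  simp [pd, fderiv_fun_add hφ.differentiableAt hψ.differentiableAt]

theorem pd_sub (hφ : AnalyticAt ℂ φ p) (hψ : AnalyticAt ℂ ψ p) :
    pd k (fun q => φ q - ψ q) p = pd k φ p - pd k ψ p := by
  simp [pd, fderiv_fun_sub hφ.differentiableAt hψ.differentiableAt]

theorem pd_neg : pd k (fun q => -φ q) p = -pd k φ p := by
  simp [pd, fderiv_fun_neg]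

theorem pd_mul (hφ : AnalyticAt ℂ φ p) (hψ : AnalyticAt ℂ ψ p) :
    pd k (fun q => φ q * ψ q) p = pd k φ p * ψ p + φ p * pd k ψ p := by
  simp [pd, fderiv_fun_mul hφ.differentiableAt hψ.differentiableAt]
  ring

theorem pd_const (c : ℂ) : pd k (fun _ => c) p = 0 := by
  simp [pd]

theorem pd_const_mul (c : ℂ) : pd k (fun q => c * φ q) p = c * pd k φ p := by
  rw [pd, show (fun q => c * φ q) = c • φ from rfl, fderiv_const_smul_field]
  rfl

theorem pd_pow (hφ : AnalyticAt ℂ φ p) (m : ℕ) :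
    pd k (fun q => φ q ^ m) p = m * φ p ^ (m - 1) * pd k φ p := by
  simp [pd, fderiv_fun_pow _ hφ.differentiableAt]

theorem pd_coord (j : Fin n) : pd k (fun q => q j) p = (Pi.single k 1 : Fin n → ℂ) j := by
  rw [pd, fderiv_apply (by fun_prop)]
  simp

theorem pd_comm (hφ : AnalyticAt ℂ φ p) (j k : Fin n) :
    pd j (pd k φ) p = pd k (pd j φ) p := by
  have h (j k : Fin n) : pd j (pd k φ) p
      = fderiv ℂ (fderiv ℂ φ) p (Pi.single j 1) (Pi.single k 1) := by
    unfold pd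
    rw [fderiv_clm_apply hφ.fderiv.differentiableAt (by fun_prop)]
    simp
  rw [h, h]
  exact hφ.contDiffAt.isSymmSndFDerivAt_of_omega _ _

theorem pd_pd_comm (hφ : AnalyticAt ℂ φ p) (i j k : Fin n) :
    pd i (pd j (pd k φ)) p = pd i (pd k (pd j φ)) p :=
  pd_congr (hφ.eventually_analyticAt.mono fun _ hq => pd_comm hq j k)

end PartialDerivatives

@[fun_prop]
theorem analyticAt_coord {n : ℕ} {p : Fin n → ℂ} (j : Fin n) :
    AnalyticAt ℂ (fun q : Fin n → ℂ => q j) p :=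
  (ContinuousLinearMap.proj (R := ℂ) (φ := fun _ : Fin n => ℂ) j).analyticAt p

/-! ### Functions of `(w, z)` -/

/-- The projection `toBase` as a continuous linear map. -/
noncomputable def toBaseL : Spacetime →L[ℂ] Base :=
  ContinuousLinearMap.pi ![ContinuousLinearMap.proj 0, ContinuousLinearMap.proj 1]

theorem coe_toBaseL : ⇑toBaseL = toBase := by
  funext p
  ext k
  fin_cases k <;> rfl

@[fun_prop]
theorem analyticAt_toBase (p : Spacetime) : AnalyticAt ℂ toBase p :=
  coe_toBaseL ▸ toBaseL.analyticAt p

section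

variable {p : Spacetime} {h : Base → ℂ}

theorem fderiv_comp_toBase (hh : AnalyticAt ℂ h (toBase p)) (u : Spacetime) :
    fderiv ℂ (fun q => h (toBase q)) p u = fderiv ℂ h (toBase p) (toBase u) := by
  have := hh.differentiableAt.hasFDerivAt.comp p
    (by simpa only [coe_toBaseL] using toBaseL.hasFDerivAt (x := p))
  rw [show (fun q => h (toBase q)) = h ∘ toBase from rfl, this.fderiv]
  simp [coe_toBaseL]

theorem pd_zero_comp_toBase (hh : AnalyticAt ℂ h (toBase p)) :
    pd 0 (fun q => h (toBase q)) p = pd 0 h (toBase p) := by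
  rw [pd, fderiv_comp_toBase hh, pd]
  congr 1
  ext k
  fin_cases k <;> simp [toBase]

theorem pd_one_comp_toBase (hh : AnalyticAt ℂ h (toBase p)) :
    pd 1 (fun q => h (toBase q)) p = pd 1 h (toBase p) := by
  rw [pd, fderiv_comp_toBase hh, pd]
  congr 1
  ext k
  fin_cases k <;> simp [toBase]

theorem pd_two_comp_toBase (hh : AnalyticAt ℂ h (toBase p)) :
    pd 2 (fun q => h (toBase q)) p = 0 := by
  have h0 : toBase (Pi.single 2 1) = 0 := by
    ext k
    fin_cases k <;> simp [toBase]
  rw [pd, fderiv_comp_toBase hh, h0, map_zero]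

theorem pd_three_comp_toBase (hh : AnalyticAt ℂ h (toBase p)) :
    pd 3 (fun q => h (toBase q)) p = 0 := by
  have h0 : toBase (Pi.single 3 1) = 0 := by
    ext k
    fin_cases k <;> simp [toBase]
  rw [pd, fderiv_comp_toBase hh, h0, map_zero]

end

/-! ### The recursion operator -/

/-- `R`-related functions solve the wave equation: it is the integrability condition
`ψ_xy = ψ_yx`. -/
theorem IsRecursion.isWave {D : Set Spacetime} {Θ φ ψ : Spacetime → ℂ} (hD : IsOpen D)
    (hΘ : AnalyticOnNhd ℂ Θ D) (hφ : AnalyticOnNhd ℂ φ D) (hψ : AnalyticOnNhd ℂ ψ D)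
    (h : IsRecursion D Θ φ ψ) : IsWave D Θ φ := by
  refine ⟨hφ, fun p hp => ?_⟩
  have hΘp := hΘ p hp
  have hφp := hφ p hp
  have h0 : pd 2 (pd 3 ψ) p = pd 2 (nabla01 Θ φ) p :=
    pd_eq_of_eqOn hD (fun q hq => (h q hq).1) hp
  have h1 : pd 3 (pd 2 ψ) p = pd 3 (fun q => -nabla11 Θ φ q) p :=
    pd_eq_of_eqOn hD (fun q hq => by rw [← (h q hq).2, nabla10, neg_neg]) hp
  rw [pd_comm (hψ p hp), h0] at h1
  unfold nabla01 nabla11 at h1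
  simp (disch := fun_prop) only [pd_add, pd_sub, pd_mul, pd_neg] at h1
  -- third derivatives of `Θ` cancel once the order of differentiation is normalised
  rw [pd_comm hφp 3 1, pd_comm hφp 3 2, pd_comm hφp 2 0,
    pd_comm (hΘp.pd (k := 2)) 3 2, pd_pd_comm hΘp 2 3 2, pd_comm (hΘp.pd (k := 3)) 3 2] at h1
  linear_combination h1

/-! ### Holomorphic functions that are constant on the fibres -/

/-- A holomorphic function with `∂_x φ = ∂_y φ = 0` is the pull-back of a holomorphic function of
`(w, z)`, as the fibres over `(w, z)` are connected. -/
theorem exists_eq_comp_toBase {D : Set Spacetime} (hD : IsOpen D)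
    (hfib : ∀ b : Base, IsPreconnected {p ∈ D | toBase p = b}) {φ : Spacetime → ℂ}
    (hφ : AnalyticOnNhd ℂ φ D) (h2 : ∀ p ∈ D, pd 2 φ p = 0) (h3 : ∀ p ∈ D, pd 3 φ p = 0) :
    ∃ G : Base → ℂ, AnalyticOnNhd ℂ G (toBase '' D) ∧ ∀ p ∈ D, φ p = G (toBase p) := by
  have hconst : ∀ p ∈ D, ∀ q ∈ D, toBase p = toBase q → φ p = φ q := by
    intro p hp q hq hpq
    -- the fibre through `p`, with the coordinates `x`, `y`
    let ι : Base → Spacetime := fun s => ![p 0, p 1, s 0, s 1]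
    have hι (s : Base) : HasFDerivAt ι (ContinuousLinearMap.pi
        (![0, 0, ContinuousLinearMap.proj 0, ContinuousLinearMap.proj 1] :
          Fin 4 → Base →L[ℂ] ℂ)) s := by
      rw [hasFDerivAt_pi']
      intro k
      fin_cases k
      · exact hasFDerivAt_const _ _
      · exact hasFDerivAt_const _ _
      · exact (ContinuousLinearMap.proj (R := ℂ) (φ := fun _ : Fin 2 => ℂ) 0).hasFDerivAt
      · exact (ContinuousLinearMap.proj (R := ℂ) (φ := fun _ : Fin 2 => ℂ) 1).hasFDerivAt
    have hbase (q : Spacetime) (h : toBase q = toBase p) : ι ![q 2, q 3] = q := by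
      have h0 := congrFun h 0
      have h1 := congrFun h 1
      simp only [toBase, Matrix.cons_val_zero, Matrix.cons_val_one] at h0 h1
      ext k
      fin_cases k
      · exact h0.symm
      · exact h1.symm
      · rfl
      · rfl
    have hpre : ι ⁻¹' D = (fun q : Spacetime => (![q 2, q 3] : Base)) ''
        {q ∈ D | toBase q = toBase p} := by
      ext s
      constructor
      · refine fun hs => ⟨ι s, ⟨hs, rfl⟩, ?_⟩
        ext k
        fin_cases k <;> rfl
      · rintro ⟨q, ⟨hq, hqp⟩, rfl⟩
        simpa only [Set.mem_preimage, hbase q hqp] using hq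
    have hder : ∀ s ∈ ι ⁻¹' D, HasFDerivAt (φ ∘ ι) (0 : Base →L[ℂ] ℂ) s := by
      intro s hs
      refine ((hφ _ hs).differentiableAt.hasFDerivAt.comp s (hι s)).congr_fderiv ?_
      refine ContinuousLinearMap.ext fun v => ?_
      rw [ContinuousLinearMap.comp_apply, fderiv_eq_pd, h2 _ hs, h3 _ hs]
      simp
    have := IsOpen.is_const_of_fderiv_eq_zero (𝕜 := ℂ) (f := φ ∘ ι)
      (hD.preimage (continuous_iff_continuousAt.2 fun s => (hι s).continuousAt))
      (hpre ▸ (hfib (toBase p)).image _ (by fun_prop))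
      (fun s hs => HasFDerivAt.differentiableAt (𝕜 := ℂ) (hder s hs) |>.differentiableWithinAt)
      (fun s hs => HasFDerivAt.fderiv (𝕜 := ℂ) (hder s hs))
      (x := ![p 2, p 3]) (y := ![q 2, q 3])
      (by simpa only [Set.mem_preimage, hbase p rfl] using hp)
      (by simpa only [Set.mem_preimage, hbase q hpq.symm] using hq)
    simpa only [Function.comp_apply, hbase p rfl, hbase q hpq.symm] using this
  have hG : ∀ p ∈ D, φ p = φ (Function.invFunOn toBase D (toBase p)) := by
    intro p hp
    have hmem : ∃ a ∈ D, toBase a = toBase p := ⟨p, hp, rfl⟩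
    exact hconst p hp _ (Function.invFunOn_mem hmem) (Function.invFunOn_eq hmem).symm
  refine ⟨fun b => φ (Function.invFunOn toBase D b), ?_, hG⟩
  rintro _ ⟨p, hp, rfl⟩
  -- near `toBase p` the function is `φ` along the section with constant `x`, `y`
  let σ : Base → Spacetime := fun b => ![b 0, b 1, p 2, p 3]
  have hσ : AnalyticAt ℂ σ (toBase p) := by
    rw [analyticAt_pi_iff]
    intro k
    fin_cases k
    · exact analyticAt_coord (n := 2) 0
    · exact analyticAt_coord (n := 2) 1
    · exact analyticAt_const
    · exact analyticAt_const
  have hσp : σ (toBase p) = p := by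
    ext k
    fin_cases k <;> rfl
  have hσt (b : Base) : toBase (σ b) = b := by
    ext k
    fin_cases k <;> rfl
  refine ((hφ (σ (toBase p)) (hσp.symm ▸ hp)).fun_comp hσ).congr ?_
  have := hσ.continuousAt.preimage_mem_nhds (hD.mem_nhds (hσp.symm ▸ hp))
  filter_upwards [this] with b hb
  rw [hG _ hb, hσt]

/-! ### Derivatives on the spin bundle -/

section SpinBundle

variable {k : Fin 4} {F G : Spacetime × ℂ → ℂ} {q : Spacetime × ℂ}

/-- The partial derivative in a space-time direction of a function on the spin bundle. -/
noncomputable def pdSpin (k : Fin 4) (F : Spacetime × ℂ → ℂ) (q : Spacetime × ℂ) : ℂ :=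
  pd k (fun p => F (p, q.2)) q.1

/-- The partial derivative `∂/∂λ` of a function on the spin bundle. -/
noncomputable def dLam (F : Spacetime × ℂ → ℂ) (q : Spacetime × ℂ) : ℂ :=
  deriv (fun l => F (q.1, l)) q.2

theorem analyticAt_slice (hF : AnalyticAt ℂ F q) : AnalyticAt ℂ (fun p => F (p, q.2)) q.1 :=
  AnalyticAt.fun_comp (g := F) (f := fun p => (p, q.2)) hF (by fun_prop)

theorem analyticAt_fibre (hF : AnalyticAt ℂ F q) : AnalyticAt ℂ (fun l => F (q.1, l)) q.2 :=
  AnalyticAt.fun_comp (g := F) (f := fun l => (q.1, l)) hF (by fun_prop)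

theorem pdSpin_eq_fderiv (hF : AnalyticAt ℂ F q) :
    pdSpin k F q = fderiv ℂ F q (Pi.single k 1, 0) := by
  have h : HasFDerivAt (fun p : Spacetime => (p, q.2))
      (ContinuousLinearMap.inl ℂ Spacetime ℂ) q.1 := hasFDerivAt_prodMk_left _ _
  have := HasFDerivAt.comp (g := F) q.1 hF.differentiableAt.hasFDerivAt h
  rw [pdSpin, pd, show (fun p => F (p, q.2)) = F ∘ fun p => (p, q.2) from rfl, this.fderiv]
  simp

theorem dLam_eq_fderiv (hF : AnalyticAt ℂ F q) : dLam F q = fderiv ℂ F q (0, 1) := by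
  have h : HasDerivAt (fun l : ℂ => (q.1, l)) (0, 1) q.2 :=
    (hasDerivAt_const _ _).prodMk (hasDerivAt_id _)
  exact (HasFDerivAt.comp_hasDerivAt (l := F) q.2 hF.differentiableAt.hasFDerivAt h).deriv

theorem analyticAt_fderiv_apply {E : Type*} [NormedAddCommGroup E] [NormedSpace ℂ E]
    {F : E → ℂ} {q : E} (hF : AnalyticAt ℂ F q) (v : E) :
    AnalyticAt ℂ (fun q => fderiv ℂ F q v) q :=
  (ContinuousLinearMap.apply ℂ ℂ v).analyticAt _ |>.fun_comp hF.fderiv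

@[fun_prop]
theorem analyticAt_pdSpin (hF : AnalyticAt ℂ F q) : AnalyticAt ℂ (pdSpin k F) q :=
  (analyticAt_fderiv_apply hF _).congr
    (hF.eventually_analyticAt.mono fun _ h => (pdSpin_eq_fderiv h).symm)

theorem analyticAt_dLam (hF : AnalyticAt ℂ F q) : AnalyticAt ℂ (dLam F) q :=
  (analyticAt_fderiv_apply hF _).congr
    (hF.eventually_analyticAt.mono fun _ h => (dLam_eq_fderiv h).symm)

theorem pdSpin_congr (h : F =ᶠ[nhds q] G) : pdSpin k F q = pdSpin k G q :=
  pd_congr ((Continuous.prodMk_left q.2).continuousAt.eventually h)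

theorem dLam_congr (h : F =ᶠ[nhds q] G) : dLam F q = dLam G q :=
  Filter.EventuallyEq.deriv_eq ((Continuous.prodMk_right q.1).continuousAt.eventually h)

/-- Symmetry of second derivatives on the spin bundle. -/
theorem pdSpin_dLam_comm (hF : AnalyticAt ℂ F q) : pdSpin k (dLam F) q = dLam (pdSpin k F) q := by
  have hF' := hF.eventually_analyticAt
  rw [pdSpin_congr (hF'.mono fun _ h => dLam_eq_fderiv h),
    dLam_congr (hF'.mono fun _ h => pdSpin_eq_fderiv h),
    pdSpin_eq_fderiv (analyticAt_fderiv_apply hF _), dLam_eq_fderiv (analyticAt_fderiv_apply hF _)]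
  have h (u v : Spacetime × ℂ) : fderiv ℂ (fun q => fderiv ℂ F q u) q v
      = fderiv ℂ (fderiv ℂ F) q v u := by
    rw [fderiv_clm_apply hF.fderiv.differentiableAt (by fun_prop)]
    simp
  rw [h, h]
  exact hF.contDiffAt.isSymmSndFDerivAt_of_omega _ _

theorem analyticAt_dLam_iterate (hF : AnalyticAt ℂ F q) (n : ℕ) : AnalyticAt ℂ (dLam^[n] F) q := by
  induction n with
  | zero => exact hF
  | succ n ih => rw [Function.iterate_succ_apply']; exact analyticAt_dLam ih

theorem pdSpin_dLam_iterate (hF : AnalyticAt ℂ F q) (n : ℕ) :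
    pdSpin k (dLam^[n] F) q = dLam^[n] (pdSpin k F) q := by
  induction n generalizing q with
  | zero => rfl
  | succ n ih =>
    rw [Function.iterate_succ_apply', Function.iterate_succ_apply',
      pdSpin_dLam_comm (analyticAt_dLam_iterate hF n)]
    exact dLam_congr (hF.eventually_analyticAt.mono fun _ h => ih h)

theorem iteratedDeriv_eq_dLam_iterate (F : Spacetime × ℂ → ℂ) (n : ℕ) (p : Spacetime) :
    iteratedDeriv n (fun l => F (p, l)) = fun l => dLam^[n] F (p, l) := by
  induction n with
  | zero => rfl
  | succ n ih =>
    rw [iteratedDeriv_succ, ih, Function.iterate_succ_apply']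
    rfl

end SpinBundle

/-! ### The contour integrals as Taylor coefficients -/

section Contour

variable {D : Set Spacetime} {r ρ : ℝ} {F G H : Spacetime × ℂ → ℂ} {p : Spacetime}

theorem ne_zero_of_mem_sphere (hρ : 0 < ρ) {l : ℂ} (hl : l ∈ Metric.sphere (0 : ℂ) ρ) : l ≠ 0 :=
  norm_pos_iff.1 (mem_sphere_zero_iff_norm.1 hl ▸ hρ)

theorem sphere_subset_ball (hρr : ρ < r) : Metric.sphere (0 : ℂ) ρ ⊆ Metric.ball 0 r :=
  Metric.sphere_subset_closedBall.trans (Metric.closedBall_subset_ball hρr)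

theorem contour_congr (hρ : 0 < ρ) (h : ∀ l ∈ Metric.sphere (0 : ℂ) ρ, F (p, l) = G (p, l)) :
    contour ρ F p = contour ρ G p := by
  unfold contour
  rw [circleIntegral.integral_congr hρ.le (g := fun l => G (p, l) / l ^ 4)
    fun l hl => by simp only [h l hl]]

theorem hidden_congr (hρ : 0 < ρ) (i : ℤ)
    (h : ∀ l ∈ Metric.sphere (0 : ℂ) ρ, F (p, l) = G (p, l)) :
    hidden ρ F i p = hidden ρ G i p :=
  contour_congr hρ fun l hl => by simp only [twist, h l hl]

/-- Multiplication by `λ` undoes a shift of the index; no regularity is needed, as the integrands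
agree on the contour. -/
theorem hidden_lam_mul (hρ : 0 < ρ) (F : Spacetime × ℂ → ℂ) (i : ℤ) (p : Spacetime) :
    hidden ρ (fun q => q.2 * F q) (i + 1) p = hidden ρ F i p :=
  contour_congr hρ fun l hl => by
    simp only [twist]
    rw [neg_add, zpow_add₀ (ne_zero_of_mem_sphere hρ hl), zpow_neg_one]
    field_simp [ne_zero_of_mem_sphere hρ hl]

theorem hidden_neg (F : Spacetime × ℂ → ℂ) (i : ℤ) (p : Spacetime) :
    hidden ρ (fun q => -F q) i p = -hidden ρ F i p := by
  have := circleIntegral.integral_const_mul (-1) (fun l => twist i F (p, l) / l ^ 4) 0 ρ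
  simp only [neg_mul, one_mul] at this
  simp only [hidden, contour, twist, mul_neg, neg_div] at *
  rw [this, mul_neg]

theorem circleIntegrable_twist (hρ : 0 < ρ) (hρr : ρ < r)
    (hF : AnalyticOnNhd ℂ F (D ×ˢ Metric.ball 0 r)) (hp : p ∈ D) (i : ℤ) :
    CircleIntegrable (fun l => twist i F (p, l) / l ^ 4) 0 ρ := by
  refine ContinuousOn.circleIntegrable hρ.le fun l hl => ContinuousAt.continuousWithinAt ?_
  have hl0 := ne_zero_of_mem_sphere hρ hl
  have hFl := (analyticAt_fibre (hF (p, l) ⟨hp, sphere_subset_ball hρr hl⟩)).continuousAt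
  exact ((continuousAt_zpow₀ _ _ (.inl hl0)).mul hFl).div (by fun_prop) (pow_ne_zero _ hl0)

theorem hidden_linear_comb (hρ : 0 < ρ) (hρr : ρ < r)
    (hF : AnalyticOnNhd ℂ F (D ×ˢ Metric.ball 0 r))
    (hG : AnalyticOnNhd ℂ G (D ×ˢ Metric.ball 0 r))
    (hH : AnalyticOnNhd ℂ H (D ×ˢ Metric.ball 0 r)) (hp : p ∈ D) (i : ℤ) (a b : ℂ) :
    hidden ρ (fun q => F q + a * G q + b * H q) i p
      = hidden ρ F i p + a * hidden ρ G i p + b * hidden ρ H i p := by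
  have iF := circleIntegrable_twist hρ hρr hF hp i
  have iG := (circleIntegrable_twist hρ hρr hG hp i).const_smul (a := a)
  have iH := (circleIntegrable_twist hρ hρr hH hp i).const_smul (a := b)
  have := circleIntegral.integral_add (iF.add iG) iH
  have h' := circleIntegral.integral_add iF iG
  simp only [Pi.add_apply] at this h'
  rw [h'] at this
  simp only [Pi.smul_apply, smul_eq_mul, circleIntegral.integral_const_mul] at this
  simp only [hidden, contour]
  rw [mul_left_comm a, mul_left_comm b, ← mul_add, ← mul_add, ← this]
  congr 2
  funext l
  simp only [twist]
  ring

theorem differentiableOn_fibre (hρr : ρ < r) (hF : AnalyticOnNhd ℂ F (D ×ˢ Metric.ball 0 r))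
    (hp : p ∈ D) : DifferentiableOn ℂ (fun l => F (p, l)) (Metric.closedBall 0 ρ) :=
  fun l hl => (analyticAt_fibre
    (hF (p, l) ⟨hp, Metric.closedBall_subset_ball hρr hl⟩)).differentiableAt.differentiableWithinAt

/-- The hidden symmetries are the Taylor coefficients in `λ` of the twistor function. -/
theorem hidden_eq_taylor (hρ : 0 < ρ) (hρr : ρ < r)
    (hF : AnalyticOnNhd ℂ F (D ×ˢ Metric.ball 0 r)) (hp : p ∈ D) (n : ℕ) :
    hidden ρ F (n - 3) p = (n.factorial : ℂ)⁻¹ * dLam^[n] F (p, 0) := by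
  have h := (differentiableOn_fibre hρr hF hp).circleIntegral_one_div_sub_center_pow_smul hρ n
  rw [iteratedDeriv_eq_dLam_iterate] at h
  rw [hidden, contour, circleIntegral.integral_congr hρ.le
    (g := fun l => (1 / (l - 0) ^ (n + 1)) • F (p, l)), h]
  · have := Complex.two_pi_I_ne_zero
    rw [smul_eq_mul]
    field_simp
  · intro l hl
    have hl0 := ne_zero_of_mem_sphere hρ hl
    simp only [twist, sub_zero, smul_eq_mul]
    rw [neg_sub, zpow_sub₀ hl0, zpow_natCast]
    norm_cast
    field_simp
    ring

theorem hidden_eq_zero (hρ : 0 < ρ) (hρr : ρ < r)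
    (hF : AnalyticOnNhd ℂ F (D ×ˢ Metric.ball 0 r)) (hp : p ∈ D) {i : ℤ} (hi : i < -3) :
    hidden ρ F i p = 0 := by
  obtain ⟨m, hm⟩ : ∃ m : ℕ, (m : ℤ) = -i - 4 := ⟨(-i - 4).toNat, by omega⟩
  have h : DifferentiableOn ℂ (fun l => l ^ m * F (p, l)) (Metric.closedBall 0 ρ) :=
    (by fun_prop : DifferentiableOn ℂ (fun l : ℂ => l ^ m) _).mul (differentiableOn_fibre hρr hF hp)
  have h0 :=
    (h.mono Metric.closure_ball_subset_closedBall).diffContOnCl.circleIntegral_eq_zero hρ.le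
  rw [hidden, contour, circleIntegral.integral_congr hρ.le (g := fun l => l ^ m * F (p, l)), h0,
    mul_zero]
  intro l hl
  have hl0 := ne_zero_of_mem_sphere hρ hl
  simp only [twist]
  rw [show -i = (m : ℤ) + (4 : ℕ) by push_cast; omega, zpow_add₀ hl0, zpow_natCast, zpow_natCast]
  field_simp

theorem analyticAt_dLam_iterate_zero (hr : 0 < r) (hF : AnalyticOnNhd ℂ F (D ×ˢ Metric.ball 0 r))
    (hp : p ∈ D) (n : ℕ) : AnalyticAt ℂ (fun p => dLam^[n] F (p, 0)) p :=
  analyticAt_slice (q := (p, 0))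
    (analyticAt_dLam_iterate (hF (p, 0) ⟨hp, Metric.mem_ball_self hr⟩) n)

theorem lt_neg_three_or_eq_natCast_sub (i : ℤ) : i < -3 ∨ ∃ n : ℕ, i = n - 3 := by
  rcases lt_or_ge i (-3) with h | h
  · exact .inl h
  · exact .inr ⟨(i + 3).toNat, by omega⟩

theorem analyticOnNhd_hidden (hD : IsOpen D) (hρ : 0 < ρ) (hρr : ρ < r)
    (hF : AnalyticOnNhd ℂ F (D ×ˢ Metric.ball 0 r)) (i : ℤ) :
    AnalyticOnNhd ℂ (hidden ρ F i) D := by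
  rcases lt_neg_three_or_eq_natCast_sub i with hi | ⟨n, rfl⟩
  · exact AnalyticOnNhd.congr hD (f := fun _ => 0) analyticOnNhd_const
      fun p hp => (hidden_eq_zero hρ hρr hF hp hi).symm
  · exact AnalyticOnNhd.congr hD (f := fun p => (n.factorial : ℂ)⁻¹ * dLam^[n] F (p, 0))
      (fun p hp => analyticAt_const.mul (analyticAt_dLam_iterate_zero (hρ.trans hρr) hF hp n))
      fun p hp => (hidden_eq_taylor hρ hρr hF hp n).symm

theorem analyticOnNhd_pdSpin {U : Set (Spacetime × ℂ)} (hF : AnalyticOnNhd ℂ F U) (k : Fin 4) :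
    AnalyticOnNhd ℂ (pdSpin k F) U :=
  fun q hq => analyticAt_pdSpin (hF q hq)

/-- Differentiation under the contour integral, in the form that Taylor coefficients in `λ` commute
with derivatives in space-time. -/
theorem pd_hidden (hD : IsOpen D) (hρ : 0 < ρ) (hρr : ρ < r)
    (hF : AnalyticOnNhd ℂ F (D ×ˢ Metric.ball 0 r)) (hp : p ∈ D) (k : Fin 4) (i : ℤ) :
    pd k (hidden ρ F i) p = hidden ρ (pdSpin k F) i p := by
  rcases lt_neg_three_or_eq_natCast_sub i with hi | ⟨n, rfl⟩
  · rw [hidden_eq_zero hρ hρr (analyticOnNhd_pdSpin hF k) hp hi,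
      pd_eq_of_eqOn hD (fun q hq => hidden_eq_zero hρ hρr hF hq hi) hp, pd_const]
  · rw [hidden_eq_taylor hρ hρr (analyticOnNhd_pdSpin hF k) hp,
      pd_eq_of_eqOn hD (fun q hq => hidden_eq_taylor hρ hρr hF hq n) hp, pd_const_mul,
      ← pdSpin_dLam_iterate (hF (p, 0) ⟨hp, Metric.mem_ball_self (hρ.trans hρr)⟩)]
    rfl

/-- Multiplying a twistor function by `λ⁻¹` applies the recursion operator: this is the Lax pair,
integrated over the contour. -/
theorem IsTwistorFunction.isRecursion_hidden {Θ : Spacetime → ℂ} (hD : IsOpen D) (hρ : 0 < ρ)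
    (hρr : ρ < r) (hF : IsTwistorFunction D Θ (Metric.ball 0 r) F) (i : ℤ) :
    IsRecursion D Θ (hidden ρ F i) (hidden ρ F (i + 1)) := by
  have hA := hF.holomorphic
  intro p hp
  simp only [nabla00, nabla10, nabla01, nabla11, pd_hidden hD hρ hρr hA hp, ← hidden_neg]
  constructor
  · have := hidden_linear_comb hρ hρr (analyticOnNhd_pdSpin hA 0)
      (analyticOnNhd_pdSpin hA 3) (analyticOnNhd_pdSpin hA 2) hp i
      (-pd 2 (pd 3 Θ) p) (pd 3 (pd 3 Θ) p)
    rw [neg_mul, ← sub_eq_add_neg] at this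
    rw [← this]
    refine Eq.trans ?_ (hidden_lam_mul hρ _ i p)
    refine hidden_congr hρ _ fun l hl => ?_
    have := hF.lax0 p hp l (sphere_subset_ball hρr hl)
    simp only [nabla00, nabla01] at this
    simp only [pdSpin]
    linear_combination this
  · have := hidden_linear_comb hρ hρr (analyticOnNhd_pdSpin hA 1)
      (analyticOnNhd_pdSpin hA 3) (analyticOnNhd_pdSpin hA 2) hp i
      (pd 2 (pd 2 Θ) p) (-pd 2 (pd 3 Θ) p)
    rw [neg_mul, ← sub_eq_add_neg] at this
    rw [← this]
    refine Eq.trans ?_ (hidden_lam_mul hρ _ i p)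
    refine hidden_congr hρ _ fun l hl => ?_
    have := hF.lax1 p hp l (sphere_subset_ball hρr hl)
    simp only [nabla10, nabla11] at this
    simp only [pdSpin]
    linear_combination this

end Contour

/-! ### The pure gauge form of `δ_M Θ` -/

section Gauge

variable {D : Set Spacetime} {Θ : Spacetime → ℂ} {r ρ : ℝ} {h g : Base → ℂ}
  {f : Spacetime × ℂ → ℂ}

theorem nabla01_congr {φ ψ : Spacetime → ℂ} {p : Spacetime} (h : φ =ᶠ[nhds p] ψ) :
    nabla01 Θ φ p = nabla01 Θ ψ p := by
  simp only [nabla01, pd_congr h]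

theorem nabla11_congr {φ ψ : Spacetime → ℂ} {p : Spacetime} (h : φ =ᶠ[nhds p] ψ) :
    nabla11 Θ φ p = nabla11 Θ ψ p := by
  simp only [nabla11, pd_congr h]

/-- `R` determines `ψ` up to a function of `(w, z)`: two functions with the same `∂_x`, `∂_y`
differ by one. -/
theorem IsRecursion.exists_eq_add {φ ψ χ : Spacetime → ℂ} (hD : IsOpen D)
    (hfib : ∀ b : Base, IsPreconnected {p ∈ D | toBase p = b})
    (hψ : AnalyticOnNhd ℂ ψ D) (hχ : AnalyticOnNhd ℂ χ D)
    (hR : IsRecursion D Θ φ ψ) (hR' : IsRecursion D Θ φ χ) :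
    ∃ G : Base → ℂ, AnalyticOnNhd ℂ G (toBase '' D) ∧ ∀ p ∈ D, ψ p = G (toBase p) + χ p := by
  obtain ⟨G, hG, h⟩ := exists_eq_comp_toBase hD hfib (hψ.sub hχ)
    (fun p hp => by
      have h1 := (hR p hp).2
      rw [← (hR' p hp).2] at h1
      rw [show ψ - χ = fun q => ψ q - χ q from rfl, pd_sub (hψ p hp) (hχ p hp)]
      simp only [nabla10] at h1
      linear_combination -h1)
    (fun p hp => by
      have h1 := (hR p hp).1
      rw [← (hR' p hp).1] at h1
      rw [show ψ - χ = fun q => ψ q - χ q from rfl, pd_sub (hψ p hp) (hχ p hp)]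
      simp only [nabla00] at h1
      linear_combination h1)
  exact ⟨G, hG, fun p hp => by rw [← h p hp, Pi.sub_apply, sub_add_cancel]⟩

theorem IsGenerator.hidden_neg_two (hρ : 0 < ρ) (hρr : ρ < r) (hf : IsGenerator D Θ r h g f)
    {p : Spacetime} (hp : p ∈ D) :
    hidden ρ f (-2) p = g (toBase p) + p 3 * pd 0 h (toBase p) - p 2 * pd 1 h (toBase p) := by
  have := hidden_eq_taylor hρ hρr hf.twistor.holomorphic hp 1
  simpa [dLam, hf.order_one p hp] using this

/-- The part of the `λ²` coefficient of a generator that is determined by `h`, `g` and `Θ`. -/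
noncomputable def quadraticPart (Θ : Spacetime → ℂ) (h g : Base → ℂ) (p : Spacetime) : ℂ :=
  p 3 * pd 0 g (toBase p) - p 2 * pd 1 g (toBase p)
    + 1 / 2 * (p 3 ^ 2 * pd 0 (pd 0 h) (toBase p) - 2 * p 2 * p 3 * pd 0 (pd 1 h) (toBase p)
      + p 2 ^ 2 * pd 1 (pd 1 h) (toBase p))
    - pd 2 Θ p * pd 0 h (toBase p) - pd 3 Θ p * pd 1 h (toBase p)

/-- The part of the `λ³` coefficient of a generator that is determined by `h`, `g`, `Θ` and the
function `G` of `(w, z)` in the `λ²` coefficient. -/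
noncomputable def cubicPart (Θ : Spacetime → ℂ) (h g G : Base → ℂ) (p : Spacetime) : ℂ :=
  p 3 * pd 0 G (toBase p) - p 2 * pd 1 G (toBase p)
    + 1 / 2 * (p 3 ^ 2 * pd 0 (pd 0 g) (toBase p) - 2 * p 2 * p 3 * pd 0 (pd 1 g) (toBase p)
      + p 2 ^ 2 * pd 1 (pd 1 g) (toBase p))
    + 1 / 6 * (p 3 ^ 3 * pd 0 (pd 0 (pd 0 h)) (toBase p)
      - 3 * p 2 * p 3 ^ 2 * pd 0 (pd 0 (pd 1 h)) (toBase p)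
      + 3 * p 2 ^ 2 * p 3 * pd 0 (pd 1 (pd 1 h)) (toBase p)
      - p 2 ^ 3 * pd 1 (pd 1 (pd 1 h)) (toBase p))
    + (-pd 1 h (toBase p) * pd 0 Θ p + pd 0 h (toBase p) * pd 1 Θ p
      - (pd 0 g (toBase p) + p 3 * pd 0 (pd 0 h) (toBase p) - p 2 * pd 0 (pd 1 h) (toBase p))
        * pd 2 Θ p
      - (pd 1 g (toBase p) + p 3 * pd 0 (pd 1 h) (toBase p) - p 2 * pd 1 (pd 1 h) (toBase p))
        * pd 3 Θ p)

theorem analyticAt_quadraticPart {p : Spacetime} (hΘ : AnalyticAt ℂ Θ p)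
    (hh : AnalyticAt ℂ h (toBase p)) (hg : AnalyticAt ℂ g (toBase p)) :
    AnalyticAt ℂ (quadraticPart Θ h g) p := by
  unfold quadraticPart
  fun_prop

theorem analyticAt_cubicPart {G : Base → ℂ} {p : Spacetime} (hΘ : AnalyticAt ℂ Θ p)
    (hh : AnalyticAt ℂ h (toBase p)) (hg : AnalyticAt ℂ g (toBase p))
    (hG : AnalyticAt ℂ G (toBase p)) : AnalyticAt ℂ (cubicPart Θ h g G) p := by
  unfold cubicPart
  fun_prop

/-- Integration of the recursion relation from the `λ` coefficient to the `λ²` coefficient. -/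
theorem isRecursion_quadraticPart (hΘ : AnalyticOnNhd ℂ Θ D)
    (hh : AnalyticOnNhd ℂ h (toBase '' D)) (hg : AnalyticOnNhd ℂ g (toBase '' D)) :
    IsRecursion D Θ (fun p => g (toBase p) + p 3 * pd 0 h (toBase p) - p 2 * pd 1 h (toBase p))
      (quadraticPart Θ h g) := by
  intro p hp
  have hΘp := hΘ p hp
  have hhp := hh _ (Set.mem_image_of_mem toBase hp)
  have hgp := hg _ (Set.mem_image_of_mem toBase hp)
  unfold nabla00 nabla10 nabla01 nabla11 quadraticPart
  simp (disch := fun_prop) only [pd_add, pd_sub, pd_mul, pd_pow, pd_const, pd_coord,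
    pd_zero_comp_toBase, pd_one_comp_toBase, pd_two_comp_toBase, pd_three_comp_toBase,
    pd_comm hhp 1 0, pd_comm hΘp 3 2]
  simp
  constructor <;> ring

/-- Integration of the recursion relation from the `λ²` coefficient to the `λ³` coefficient. The
integrability condition is the heavenly equation, multiplied by the derivatives of `h`. -/
theorem isRecursion_cubicPart {G : Base → ℂ} (hΘ : AnalyticOnNhd ℂ Θ D) (hheav : IsHeavenly D Θ)
    (hh : AnalyticOnNhd ℂ h (toBase '' D)) (hg : AnalyticOnNhd ℂ g (toBase '' D))
    (hG : AnalyticOnNhd ℂ G (toBase '' D)) :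
    IsRecursion D Θ (fun p => G (toBase p) + quadraticPart Θ h g p) (cubicPart Θ h g G) := by
  intro p hp
  have hΘp := hΘ p hp
  have hhp := hh _ (Set.mem_image_of_mem toBase hp)
  have hgp := hg _ (Set.mem_image_of_mem toBase hp)
  have hGp := hG _ (Set.mem_image_of_mem toBase hp)
  have heq := hheav p hp
  unfold nabla00 nabla10 nabla01 nabla11 quadraticPart cubicPart
  simp (disch := fun_prop) only [pd_add, pd_sub, pd_neg, pd_mul, pd_pow, pd_const, pd_coord,
    pd_zero_comp_toBase, pd_one_comp_toBase, pd_two_comp_toBase, pd_three_comp_toBase,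
    pd_comm hhp 1 0, pd_comm hgp 1 0, pd_comm hΘp 3 2, pd_comm hΘp 2 1, pd_comm hΘp 3 1,
    pd_comm hΘp 2 0, pd_comm hΘp 3 0, pd_comm (hhp.pd (k := 0)) 1 0, pd_comm (hhp.pd (k := 1)) 1 0,
    pd_pd_comm hhp 0 1 0]
  simp
  constructor
  · linear_combination pd 0 h (toBase p) * heq
  · linear_combination pd 1 h (toBase p) * heq

theorem IsRecursion.congr_left {φ φ' ψ : Spacetime → ℂ} (hD : IsOpen D)
    (h : Set.EqOn φ φ' D) (hR : IsRecursion D Θ φ ψ) : IsRecursion D Θ φ' ψ := by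
  intro p hp
  have := h.eventuallyEq_of_mem (hD.mem_nhds hp)
  rw [← nabla01_congr this, ← nabla11_congr this]
  exact hR p hp

/-- Two steps of the recursion lead from the `λ` coefficient `g + x^A ∂h/∂w^A` of a generator to its
`λ³` coefficient `δ_M Θ`. Each step is known up to a function of `(w, z)`; these functions are the
`G` (whose derivatives are the `G^A`) and the `F` of the pure gauge element. -/
theorem IsGenerator.isPureGauge (hD : IsOpen D)
    (hfib : ∀ b : Base, IsPreconnected {p ∈ D | toBase p = b}) (hΘ : AnalyticOnNhd ℂ Θ D)
    (hheav : IsHeavenly D Θ) (hρ : 0 < ρ) (hρr : ρ < r) (hf : IsGenerator D Θ r h g f) :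
    IsPureGauge D Θ h g (hidden ρ f 0) := by
  have hh := hf.holomorphic_h
  have hg := hf.holomorphic_g
  have hmem {p : Spacetime} (hp : p ∈ D) : toBase p ∈ toBase '' D := ⟨p, hp, rfl⟩
  have hrec2 : IsRecursion D Θ (hidden ρ f (-2)) (hidden ρ f (-1)) :=
    hf.twistor.isRecursion_hidden hD hρ hρr (-2)
  have hrec1 : IsRecursion D Θ (hidden ρ f (-1)) (hidden ρ f 0) :=
    hf.twistor.isRecursion_hidden hD hρ hρr (-1)
  have han := analyticOnNhd_hidden hD hρ hρr hf.twistor.holomorphic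
  obtain ⟨G, hG, hG'⟩ := (hrec2.congr_left hD
      fun p hp => hf.hidden_neg_two hρ hρr hp).exists_eq_add hD hfib (han _)
    (fun p hp => analyticAt_quadraticPart (hΘ p hp) (hh _ (hmem hp)) (hg _ (hmem hp)))
    (isRecursion_quadraticPart hΘ hh hg)
  obtain ⟨F, hF, hF'⟩ := (hrec1.congr_left hD hG').exists_eq_add hD hfib (han _)
    (fun p hp => analyticAt_cubicPart (hΘ p hp) (hh _ (hmem hp)) (hg _ (hmem hp)) (hG _ (hmem hp)))
    (isRecursion_cubicPart hΘ hheav hh hg hG)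
  refine ⟨F, fun b => -pd 1 G b, pd 0 G, hF, fun b hb => ((hG b hb).pd).neg,
    fun b hb => (hG b hb).pd, fun p hp => ?_⟩
  rw [fderiv_eq_pd, hF' p hp, cubicPart]
  simp only [residualField, Matrix.cons_val]
  ring

end Gauge

/-! ### The Lie algebra of residual fields -/

section Residual

variable {D : Set Spacetime} {h g h' g' : Base → ℂ} {p : Spacetime}

theorem analyticAt_residualField (hh : AnalyticAt ℂ h (toBase p)) (hg : AnalyticAt ℂ g (toBase p)) :
    AnalyticAt ℂ (residualField h g) p := by
  rw [analyticAt_pi_iff]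
  intro k
  unfold residualField
  fin_cases k <;> simp only [Fin.reduceFinMk, Matrix.cons_val, Fin.zero_eta, Fin.mk_one] <;>
    fun_prop

theorem fderiv_residualField_apply (hh : AnalyticAt ℂ h (toBase p)) (hg : AnalyticAt ℂ g (toBase p))
    (u : Spacetime) (k : Fin 4) :
    fderiv ℂ (residualField h g) p u k = u 0 * pd 0 (fun q => residualField h g q k) p
      + u 1 * pd 1 (fun q => residualField h g q k) p
      + u 2 * pd 2 (fun q => residualField h g q k) p
      + u 3 * pd 3 (fun q => residualField h g q k) p := by
  rw [← fderiv_eq_pd, fderiv_apply (analyticAt_residualField hh hg).differentiableAt]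
  simp

theorem isResidual_residualField (hh : AnalyticOnNhd ℂ h (toBase '' D))
    (hg : AnalyticOnNhd ℂ g (toBase '' D)) : IsResidual D (residualField h g) := by
  have hmem {p : Spacetime} (hp : p ∈ D) : toBase p ∈ toBase '' D := ⟨p, hp, rfl⟩
  refine ⟨fun p hp => analyticAt_residualField (hh _ (hmem hp)) (hg _ (hmem hp)),
    fun p hp => ?_, fun p hp u v => ?_, fun p hp u v => ?_⟩
  all_goals
    have hhp := hh _ (hmem hp)
    have hgp := hg _ (hmem hp)
  · simp only [Fin.sum_univ_four, residualField, Matrix.cons_val]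
    simp (disch := fun_prop) only [pd_add, pd_sub, pd_neg, pd_mul, pd_coord,
      pd_zero_comp_toBase, pd_one_comp_toBase, pd_two_comp_toBase, pd_three_comp_toBase,
      pd_comm hhp 1 0]
    simp
  · simp only [lieDerivConst, sigma11, fderiv_residualField_apply hhp hgp]
    simp only [residualField, Matrix.cons_val]
    simp (disch := fun_prop) only [pd_neg, pd_zero_comp_toBase, pd_one_comp_toBase,
      pd_two_comp_toBase, pd_three_comp_toBase, pd_comm hhp 1 0]
    ring
  · simp only [lieDerivConst, sigma01, fderiv_residualField_apply hhp hgp]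
    simp only [residualField, Matrix.cons_val]
    simp (disch := fun_prop) only [pd_add, pd_sub, pd_neg, pd_mul, pd_coord,
      pd_zero_comp_toBase, pd_one_comp_toBase, pd_two_comp_toBase, pd_three_comp_toBase,
      pd_comm hhp 1 0, pd_comm hgp 1 0, pd_comm (hhp.pd (k := 0)) 1 0,
      pd_comm (hhp.pd (k := 1)) 1 0, pd_pd_comm hhp 0 1 0]
    simp
    ring

/-- The Poisson bracket `∂_w h ∂_z k - ∂_z h ∂_w k` of functions of `(w, z)`. -/
noncomputable def basePoisson (h k : Base → ℂ) (b : Base) : ℂ :=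
  pd 0 h b * pd 1 k b - pd 1 h b * pd 0 k b

@[fun_prop]
theorem analyticAt_basePoisson {h k : Base → ℂ} {b : Base} (hh : AnalyticAt ℂ h b)
    (hk : AnalyticAt ℂ k b) : AnalyticAt ℂ (basePoisson h k) b := by
  unfold basePoisson
  fun_prop

theorem pd_basePoisson {h k : Base → ℂ} {b : Base} (hh : AnalyticAt ℂ h b)
    (hk : AnalyticAt ℂ k b) (j : Fin 2) :
    pd j (basePoisson h k) b = basePoisson (pd j h) k b + basePoisson h (pd j k) b := by
  unfold basePoisson
  simp (disch := fun_prop) only [pd_sub, pd_mul, pd_comm hh j, pd_comm hk j]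
  ring

theorem pd_pd_basePoisson {h k : Base → ℂ} {b : Base} (hh : AnalyticAt ℂ h b)
    (hk : AnalyticAt ℂ k b) (i j : Fin 2) :
    pd i (pd j (basePoisson h k)) b
      = basePoisson (pd i (pd j h)) k b + basePoisson (pd j h) (pd i k) b
        + (basePoisson (pd i h) (pd j k) b + basePoisson h (pd i (pd j k)) b) := by
  rw [pd_congr (φ := pd j (basePoisson h k))
      (ψ := fun b => basePoisson (pd j h) k b + basePoisson h (pd j k) b)
      (by filter_upwards [hh.eventually_analyticAt, hk.eventually_analyticAt] with b h1 h2
          exact pd_basePoisson h1 h2 j),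
    pd_add (by fun_prop) (by fun_prop), pd_basePoisson (by fun_prop) (by fun_prop),
    pd_basePoisson (by fun_prop) (by fun_prop)]

/-- The residual fields form a Lie algebra: that of the jets `h + λ g` under the Poisson bracket. -/
theorem residualField_basePoisson (hh : AnalyticAt ℂ h (toBase p))
    (hg : AnalyticAt ℂ g (toBase p)) (hh' : AnalyticAt ℂ h' (toBase p))
    (hg' : AnalyticAt ℂ g' (toBase p)) :
    residualField (basePoisson h h') (fun b => basePoisson g h' b + basePoisson h g' b) p
      = VectorField.lieBracket ℂ (residualField h g) (residualField h' g') p := by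
  ext k
  rw [VectorField.lieBracket, Pi.sub_apply, fderiv_residualField_apply hh hg,
    fderiv_residualField_apply hh' hg']
  fin_cases k <;> simp only [Fin.reduceFinMk, Fin.zero_eta, Fin.mk_one, residualField,
    Matrix.cons_val] <;>
  simp (disch := fun_prop) only [pd_add, pd_sub, pd_neg, pd_mul, pd_coord,
      pd_zero_comp_toBase, pd_one_comp_toBase, pd_two_comp_toBase, pd_three_comp_toBase,
      pd_basePoisson, pd_pd_basePoisson] <;>
  simp only [basePoisson, pd_comm hh 1 0, pd_comm hg 1 0, pd_comm (hh.pd (k := 0)) 1 0,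
      pd_comm (hh.pd (k := 1)) 1 0, pd_pd_comm hh 0 1 0, pd_comm hh' 1 0, pd_comm hg' 1 0,
      pd_comm (hh'.pd (k := 0)) 1 0, pd_comm (hh'.pd (k := 1)) 1 0, pd_pd_comm hh' 0 1 0] <;>
  simp <;> ring

end Residual

/-! ### Poisson brackets of twistor functions -/

section Bracket

variable {D : Set Spacetime} {Θ : Spacetime → ℂ}

/-- The Lax equations at a fixed value of `λ` imply the wave equation: for `λ ≠ 0` they say that
`λ⁻¹ F = R F`. -/
theorem isWave_of_lax (hD : IsOpen D) (hΘ : AnalyticOnNhd ℂ Θ D) {F : Spacetime → ℂ}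
    (hF : AnalyticOnNhd ℂ F D) {l : ℂ} (h0 : ∀ p ∈ D, nabla00 F p - l * nabla01 Θ F p = 0)
    (h1 : ∀ p ∈ D, nabla10 F p - l * nabla11 Θ F p = 0) : IsWave D Θ F := by
  rcases eq_or_ne l 0 with rfl | hl
  · -- on `λ = 0` the function depends on `(w, z)` only
    refine ⟨hF, fun p hp => ?_⟩
    have h3 : Set.EqOn (pd 3 F) (fun _ => 0) D := fun q hq => by
      simpa [nabla00] using h0 q hq
    have h2 : Set.EqOn (pd 2 F) (fun _ => 0) D := fun q hq => by
      simpa [nabla10] using h1 q hq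
    simp only [pd_eq_of_eqOn hD h3 hp, pd_eq_of_eqOn hD h2 hp, pd_const]
    ring
  · have hψ : AnalyticOnNhd ℂ (fun q => l⁻¹ * F q) D := fun p hp => analyticAt_const.mul (hF p hp)
    refine IsRecursion.isWave hD hΘ hF hψ fun p hp => ?_
    have h0p := h0 p hp
    have h1p := h1 p hp
    simp only [nabla00, nabla10, pd_const_mul] at *
    constructor
    · field_simp
      linear_combination h0p
    · field_simp
      linear_combination h1p

/-- For a solution `F` of the Lax equations at a fixed value of `λ`, the Lax pair acts on the
vector `(∇_{01'} F, ∇_{11'} F)` by trace-free matrices. -/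
theorem lax_nabla (hD : IsOpen D) (hΘ : AnalyticOnNhd ℂ Θ D) {F : Spacetime → ℂ}
    (hF : AnalyticOnNhd ℂ F D) {l : ℂ} (h0 : ∀ p ∈ D, nabla00 F p - l * nabla01 Θ F p = 0)
    (h1 : ∀ p ∈ D, nabla10 F p - l * nabla11 Θ F p = 0) {p : Spacetime} (hp : p ∈ D) :
    (nabla00 (nabla01 Θ F) p - l * nabla01 Θ (nabla01 Θ F) p
      = -l * (pd 3 (pd 2 (pd 3 Θ)) p * nabla01 Θ F p + pd 3 (pd 3 (pd 3 Θ)) p * nabla11 Θ F p) ∧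
    nabla00 (nabla11 Θ F) p - l * nabla01 Θ (nabla11 Θ F) p
      = l * (pd 2 (pd 2 (pd 3 Θ)) p * nabla01 Θ F p + pd 3 (pd 2 (pd 3 Θ)) p * nabla11 Θ F p)) ∧
    nabla10 (nabla01 Θ F) p - l * nabla11 Θ (nabla01 Θ F) p
      = l * (pd 2 (pd 2 (pd 3 Θ)) p * nabla01 Θ F p + pd 3 (pd 2 (pd 3 Θ)) p * nabla11 Θ F p) ∧
    nabla10 (nabla11 Θ F) p - l * nabla11 Θ (nabla11 Θ F) p
      = -l * (pd 2 (pd 2 (pd 2 Θ)) p * nabla01 Θ F p + pd 2 (pd 2 (pd 3 Θ)) p * nabla11 Θ F p) := by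
  -- the wave equation takes the place of the vanishing of `[∇_{01'}, ∇_{11'}]`
  have hwave := (isWave_of_lax hD hΘ hF h0 h1).wave p hp
  have hΘp := hΘ p hp
  have hFp := hF p hp
  have hu (k : Fin 4) : pd k (pd 3 F) p = l * pd k (nabla01 Θ F) p := by
    rw [← pd_const_mul]
    exact pd_eq_of_eqOn hD (fun q hq => sub_eq_zero.1 (h0 q hq)) hp
  have hv (k : Fin 4) : pd k (pd 2 F) p = -(l * pd k (nabla11 Θ F) p) := by
    rw [← pd_const_mul, ← pd_neg]
    exact pd_eq_of_eqOn hD (fun q hq => by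
      have := sub_eq_zero.1 (h1 q hq)
      rw [nabla10] at this
      rw [← this, neg_neg]) hp
  have hpu (k : Fin 4) : pd k (nabla01 Θ F) p = pd k (pd 0 F) p
      - (pd k (pd 2 (pd 3 Θ)) p * pd 3 F p + pd 2 (pd 3 Θ) p * pd k (pd 3 F) p)
      + (pd k (pd 3 (pd 3 Θ)) p * pd 2 F p + pd 3 (pd 3 Θ) p * pd k (pd 2 F) p) := by
    unfold nabla01
    simp (disch := fun_prop) only [pd_add, pd_sub, pd_mul]
  have hpv (k : Fin 4) : pd k (nabla11 Θ F) p = pd k (pd 1 F) p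
      + (pd k (pd 2 (pd 2 Θ)) p * pd 3 F p + pd 2 (pd 2 Θ) p * pd k (pd 3 F) p)
      - (pd k (pd 2 (pd 3 Θ)) p * pd 2 F p + pd 2 (pd 3 Θ) p * pd k (pd 2 F) p) := by
    unfold nabla11
    simp (disch := fun_prop) only [pd_add, pd_sub, pd_mul]
  have h0p := h0 p hp
  have h1p := h1 p hp
  have e1 : pd 3 (pd 2 (pd 2 Θ)) p = pd 2 (pd 2 (pd 3 Θ)) p := by
    rw [pd_comm hΘp.pd, pd_pd_comm hΘp]
  have e2 : pd 2 (pd 3 (pd 3 Θ)) p = pd 3 (pd 2 (pd 3 Θ)) p := pd_comm hΘp.pd _ _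
  have c1 := pd_comm hFp 3 0
  have c2 := pd_comm hFp 3 1
  have c3 := pd_comm hFp 3 2
  have c4 := pd_comm hFp 2 0
  have c5 := pd_comm hFp 2 1
  have u0 := hu 0
  have u1 := hu 1
  have u2 := hu 2
  have u3 := hu 3
  have v0 := hv 0
  have v1 := hv 1
  have v2 := hv 2
  have v3 := hv 3
  have pu3 := hpu 3
  have pu2 := hpu 2
  have pv3 := hpv 3
  have pv2 := hpv 2
  rw [c3] at v3
  rw [e1] at pv3
  rw [e2] at pu2
  rw [c1, c3] at pu3
  rw [c2, c3] at pv3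
  rw [c4] at pu2
  rw [c5] at pv2
  generalize hU : nabla01 Θ F = U at *
  generalize hV : nabla11 Θ F = V at *
  simp only [nabla00, nabla10] at h0p h1p
  simp only [nabla00, nabla10, nabla01, nabla11]
  refine ⟨⟨?_, ?_⟩, ?_, ?_⟩
  · linear_combination pu3 + u0 - pd 2 (pd 3 Θ) p * u3 + pd 3 (pd 3 Θ) p * u2
      - pd 3 (pd 2 (pd 3 Θ)) p * h0p - pd 3 (pd 3 (pd 3 Θ)) p * h1p
  · linear_combination pv3 - v0 + pd 2 (pd 3 Θ) p * v3 - pd 3 (pd 3 Θ) p * v2 + hwave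
      + pd 2 (pd 2 (pd 3 Θ)) p * h0p + pd 3 (pd 2 (pd 3 Θ)) p * h1p
  · linear_combination -pu2 + u1 + pd 2 (pd 2 Θ) p * u3 - pd 2 (pd 3 Θ) p * u2 - hwave
      + pd 2 (pd 2 (pd 3 Θ)) p * h0p + pd 3 (pd 2 (pd 3 Θ)) p * h1p
  · linear_combination -pv2 - v1 - pd 2 (pd 2 Θ) p * v3 + pd 2 (pd 3 Θ) p * v2
      - pd 2 (pd 2 (pd 2 Θ)) p * h0p - pd 2 (pd 2 (pd 3 Θ)) p * h1p

variable {Λ : Set ℂ} {f k : Spacetime × ℂ → ℂ}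

theorem analyticAt_poisson {q : Spacetime × ℂ} (hΘ : AnalyticAt ℂ Θ q.1) (hf : AnalyticAt ℂ f q)
    (hk : AnalyticAt ℂ k q) : AnalyticAt ℂ (poisson Θ f k) q := by
  have hd (i j : Fin 4) : AnalyticAt ℂ (fun q : Spacetime × ℂ => pd i (pd j Θ) q.1) q :=
    AnalyticAt.fun_comp (g := pd i (pd j Θ)) hΘ.pd.pd analyticAt_fst
  have h0 {f : Spacetime × ℂ → ℂ} (hf : AnalyticAt ℂ f q) :
      AnalyticAt ℂ (fun q => nabla01 Θ (fun p => f (p, q.2)) q.1) q :=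
    ((analyticAt_pdSpin (k := 0) hf).sub ((hd 2 3).mul (analyticAt_pdSpin (k := 3) hf))).add
      ((hd 3 3).mul (analyticAt_pdSpin (k := 2) hf))
  have h1 {f : Spacetime × ℂ → ℂ} (hf : AnalyticAt ℂ f q) :
      AnalyticAt ℂ (fun q => nabla11 Θ (fun p => f (p, q.2)) q.1) q :=
    ((analyticAt_pdSpin (k := 1) hf).add ((hd 2 2).mul (analyticAt_pdSpin (k := 3) hf))).sub
      ((hd 2 3).mul (analyticAt_pdSpin (k := 2) hf))
  exact ((h0 hf).mul (h1 hk)).sub ((h1 hf).mul (h0 hk))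

/-- Twistor functions are closed under the Poisson bracket: the bracket of `f` and `k` is the
determinant of the vectors `(∇_{01'} f, ∇_{11'} f)` and `(∇_{01'} k, ∇_{11'} k)`, which
trace-free matrices annihilate. -/
theorem IsTwistorFunction.poisson (hD : IsOpen D) (hΘ : AnalyticOnNhd ℂ Θ D)
    (hf : IsTwistorFunction D Θ Λ f) (hk : IsTwistorFunction D Θ Λ k) :
    IsTwistorFunction D Θ Λ (poisson Θ f k) := by
  have hslice {f : Spacetime × ℂ → ℂ} (hf : IsTwistorFunction D Θ Λ f) {l : ℂ} (hl : l ∈ Λ) :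
      AnalyticOnNhd ℂ (fun q => f (q, l)) D :=
    fun p hp => analyticAt_slice (q := (p, l)) (hf.holomorphic (p, l) ⟨hp, hl⟩)
  have hu {φ : Spacetime → ℂ} {p : Spacetime} (hp : p ∈ D) (h : AnalyticAt ℂ φ p) :
      AnalyticAt ℂ (nabla01 Θ φ) p := by
    have := hΘ p hp
    unfold nabla01
    fun_prop
  have hv {φ : Spacetime → ℂ} {p : Spacetime} (hp : p ∈ D) (h : AnalyticAt ℂ φ p) :
      AnalyticAt ℂ (nabla11 Θ φ) p := by
    have := hΘ p hp
    unfold nabla11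
    fun_prop
  have hpd {p : Spacetime} (hp : p ∈ D) {l : ℂ} (hl : l ∈ Λ) (j : Fin 4) :
      pd j (fun q => Heavenly.poisson Θ f k (q, l)) p
        = pd j (nabla01 Θ fun q => f (q, l)) p * nabla11 Θ (fun q => k (q, l)) p
          + nabla01 Θ (fun q => f (q, l)) p * pd j (nabla11 Θ fun q => k (q, l)) p
          - (pd j (nabla11 Θ fun q => f (q, l)) p * nabla01 Θ (fun q => k (q, l)) p
            + nabla11 Θ (fun q => f (q, l)) p * pd j (nabla01 Θ fun q => k (q, l)) p) := by
    have hfu := hu hp (hslice hf hl p hp)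
    have hfv := hv hp (hslice hf hl p hp)
    have hku := hu hp (hslice hk hl p hp)
    have hkv := hv hp (hslice hk hl p hp)
    unfold Heavenly.poisson
    rw [pd_sub (hfu.fun_mul hkv) (hfv.fun_mul hku), pd_mul hfu hkv, pd_mul hfv hku]
  refine ⟨fun q hq => analyticAt_poisson (hΘ _ hq.1) (hf.holomorphic q hq) (hk.holomorphic q hq),
    fun p hp l hl => ?_, fun p hp l hl => ?_⟩
  all_goals
    obtain ⟨⟨f1, f2⟩, f3, f4⟩ := lax_nabla hD hΘ (hslice hf hl) (fun p hp => hf.lax0 p hp l hl)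
      (fun p hp => hf.lax1 p hp l hl) hp
    obtain ⟨⟨k1, k2⟩, k3, k4⟩ := lax_nabla hD hΘ (hslice hk hl) (fun p hp => hk.lax0 p hp l hl)
      (fun p hp => hk.lax1 p hp l hl) hp
    have hP := hpd hp hl
    generalize hfU : nabla01 Θ (fun q => f (q, l)) = fU at *
    generalize hfV : nabla11 Θ (fun q => f (q, l)) = fV at *
    generalize hkU : nabla01 Θ (fun q => k (q, l)) = kU at *
    generalize hkV : nabla11 Θ (fun q => k (q, l)) = kV at *
    simp only [nabla00, nabla10, nabla01, nabla11] at f1 f2 f3 f4 k1 k2 k3 k4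
    simp only [nabla00, nabla10, nabla01, nabla11, hP]
  · linear_combination kV p * f1 + fU p * k2 - kU p * f2 - fV p * k1
  · linear_combination kV p * f3 + fU p * k4 - kU p * f4 - fV p * k3

/-! ### Brackets of generators -/

variable {r ρ : ℝ} {h g h' g' : Base → ℂ}

theorem IsGenerator.nabla01_zero (hD : IsOpen D) (hf : IsGenerator D Θ r h g f) {p : Spacetime}
    (hp : p ∈ D) : nabla01 Θ (fun q => f (q, 0)) p = pd 0 h (toBase p) := by
  have hh := hf.holomorphic_h _ (Set.mem_image_of_mem toBase hp)
  rw [nabla01_congr (Set.EqOn.eventuallyEq_of_mem hf.order_zero (hD.mem_nhds hp))]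
  simp (disch := fun_prop) only [nabla01, pd_zero_comp_toBase, pd_two_comp_toBase,
    pd_three_comp_toBase]
  ring

theorem IsGenerator.nabla11_zero (hD : IsOpen D) (hf : IsGenerator D Θ r h g f) {p : Spacetime}
    (hp : p ∈ D) : nabla11 Θ (fun q => f (q, 0)) p = pd 1 h (toBase p) := by
  have hh := hf.holomorphic_h _ (Set.mem_image_of_mem toBase hp)
  rw [nabla11_congr (Set.EqOn.eventuallyEq_of_mem hf.order_zero (hD.mem_nhds hp))]
  simp (disch := fun_prop) only [nabla11, pd_one_comp_toBase, pd_two_comp_toBase,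
    pd_three_comp_toBase]
  ring

/-- Space-time derivatives commute with the expansion in `λ` to first order. -/
theorem IsGenerator.hasDerivAt_pd (hD : IsOpen D) (hr : 0 < r) (hf : IsGenerator D Θ r h g f)
    {p : Spacetime} (hp : p ∈ D) (j : Fin 4) :
    HasDerivAt (fun l => pd j (fun q => f (q, l)) p) (pd j (fun q => g (toBase q)
      + q 3 * pd 0 h (toBase q) - q 2 * pd 1 h (toBase q)) p) 0 := by
  have hfp := hf.twistor.holomorphic (p, 0) ⟨hp, Metric.mem_ball_self hr⟩
  have h1 := (analyticAt_fibre (analyticAt_pdSpin (k := j) hfp)).differentiableAt.hasDerivAt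
  have h2 : deriv (fun l => pdSpin j f (p, l)) 0 = pdSpin j (dLam f) (p, 0) :=
    (pdSpin_dLam_comm hfp).symm
  rw [h2] at h1
  have h3 : pdSpin j (dLam f) (p, 0) = _ := pd_eq_of_eqOn hD hf.order_one hp
  rw [h3] at h1
  exact h1

theorem IsGenerator.hasDerivAt_nabla01 (hD : IsOpen D) (hr : 0 < r) (hf : IsGenerator D Θ r h g f)
    {p : Spacetime} (hp : p ∈ D) :
    HasDerivAt (fun l => nabla01 Θ (fun q => f (q, l)) p) (pd 0 g (toBase p)
      + p 3 * pd 0 (pd 0 h) (toBase p) - p 2 * pd 0 (pd 1 h) (toBase p)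
      - pd 2 (pd 3 Θ) p * pd 0 h (toBase p) - pd 3 (pd 3 Θ) p * pd 1 h (toBase p)) 0 := by
  have hh := hf.holomorphic_h _ (Set.mem_image_of_mem toBase hp)
  have hg := hf.holomorphic_g _ (Set.mem_image_of_mem toBase hp)
  refine HasDerivAt.congr_deriv (((hf.hasDerivAt_pd hD hr hp 0).sub
    ((hf.hasDerivAt_pd hD hr hp 3).const_mul (pd 2 (pd 3 Θ) p))).add
    ((hf.hasDerivAt_pd hD hr hp 2).const_mul (pd 3 (pd 3 Θ) p))) ?_
  simp (disch := fun_prop) only [pd_add, pd_sub, pd_mul, pd_coord, pd_zero_comp_toBase,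
    pd_two_comp_toBase, pd_three_comp_toBase]
  simp
  ring

theorem IsGenerator.hasDerivAt_nabla11 (hD : IsOpen D) (hr : 0 < r) (hf : IsGenerator D Θ r h g f)
    {p : Spacetime} (hp : p ∈ D) :
    HasDerivAt (fun l => nabla11 Θ (fun q => f (q, l)) p) (pd 1 g (toBase p)
      + p 3 * pd 0 (pd 1 h) (toBase p) - p 2 * pd 1 (pd 1 h) (toBase p)
      + pd 2 (pd 2 Θ) p * pd 0 h (toBase p) + pd 2 (pd 3 Θ) p * pd 1 h (toBase p)) 0 := by
  have hh := hf.holomorphic_h _ (Set.mem_image_of_mem toBase hp)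
  have hg := hf.holomorphic_g _ (Set.mem_image_of_mem toBase hp)
  refine HasDerivAt.congr_deriv (((hf.hasDerivAt_pd hD hr hp 1).add
    ((hf.hasDerivAt_pd hD hr hp 3).const_mul (pd 2 (pd 2 Θ) p))).sub
    ((hf.hasDerivAt_pd hD hr hp 2).const_mul (pd 2 (pd 3 Θ) p))) ?_
  simp (disch := fun_prop) only [pd_add, pd_sub, pd_mul, pd_coord, pd_one_comp_toBase,
    pd_two_comp_toBase, pd_three_comp_toBase, pd_comm hh 1 0]
  simp

/-- The Poisson bracket of generators generates the bracket of the residual fields. To first order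
in `λ` the terms with second derivatives of `Θ` cancel. -/
theorem IsGenerator.poisson (hD : IsOpen D) (hΘ : AnalyticOnNhd ℂ Θ D) (hr : 0 < r)
    (hf : IsGenerator D Θ r h g f) (hk : IsGenerator D Θ r h' g' k) :
    IsGenerator D Θ r (basePoisson h h') (fun b => basePoisson g h' b + basePoisson h g' b)
      (poisson Θ f k) where
  holomorphic_h b hb :=
    analyticAt_basePoisson (hf.holomorphic_h b hb) (hk.holomorphic_h b hb)
  holomorphic_g b hb :=
    (analyticAt_basePoisson (hf.holomorphic_g b hb) (hk.holomorphic_h b hb)).add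
      (analyticAt_basePoisson (hf.holomorphic_h b hb) (hk.holomorphic_g b hb))
  twistor := hf.twistor.poisson hD hΘ hk.twistor
  order_zero p hp := by
    rw [Heavenly.poisson, hf.nabla01_zero hD hp, hf.nabla11_zero hD hp, hk.nabla01_zero hD hp,
      hk.nabla11_zero hD hp, basePoisson]
  order_one p hp := by
    have hh := hf.holomorphic_h _ (Set.mem_image_of_mem toBase hp)
    have hh' := hk.holomorphic_h _ (Set.mem_image_of_mem toBase hp)
    have h1 := ((hf.hasDerivAt_nabla01 hD hr hp).mul (hk.hasDerivAt_nabla11 hD hr hp)).sub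
      ((hf.hasDerivAt_nabla11 hD hr hp).mul (hk.hasDerivAt_nabla01 hD hr hp))
    refine h1.deriv.trans ?_
    rw [hf.nabla01_zero hD hp, hf.nabla11_zero hD hp, hk.nabla01_zero hD hp,
      hk.nabla11_zero hD hp, pd_basePoisson hh hh', pd_basePoisson hh hh']
    simp only [basePoisson, pd_comm hh 1 0, pd_comm hh' 1 0]
    ring

theorem IsGenerator.isHiddenTower (hD : IsOpen D)
    (hfib : ∀ b : Base, IsPreconnected {p ∈ D | toBase p = b}) (hΘ : AnalyticOnNhd ℂ Θ D)
    (hheav : IsHeavenly D Θ) (hρ : 0 < ρ) (hρr : ρ < r) (hf : IsGenerator D Θ r h g f) :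
    IsHiddenTower D Θ h g (hidden ρ f) where
  residual := isResidual_residualField hf.holomorphic_h hf.holomorphic_g
  gauge := hf.isPureGauge hD hfib hΘ hheav hρ hρr
  wave i := (hf.twistor.isRecursion_hidden hD hρ hρr i).isWave hD hΘ
    (analyticOnNhd_hidden hD hρ hρr hf.twistor.holomorphic i)
    (analyticOnNhd_hidden hD hρ hρr hf.twistor.holomorphic (i + 1))
  recursion := hf.twistor.isRecursion_hidden hD hρ hρr

theorem poisson_twist {q : Spacetime × ℂ} (hq : q.2 ≠ 0) (i j : ℤ) :
    poisson Θ (twist i f) (twist j k) q = twist (i + j) (poisson Θ f k) q := by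
  simp only [poisson, nabla01, nabla11, twist, pd_const_mul, neg_add, zpow_add₀ hq]
  ring

/-- Powers of `λ` are constants for the fibrewise Poisson bracket, so the bracket of hidden
symmetries is a hidden symmetry of the bracket. -/
theorem hiddenBracket_eq_hidden (hρ : 0 < ρ) (i j : ℤ) (p : Spacetime) :
    hiddenBracket ρ Θ f k i j p = hidden ρ (poisson Θ f k) (i + j) p :=
  contour_congr hρ fun _ hl => poisson_twist (ne_zero_of_mem_sphere hρ hl) i j

end Bracket

end Heavenly

theorem mainTheorem4
    (D : Set Spacetime) (hD : IsOpen D)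
    (hfib : ∀ b : Base, IsPreconnected {p ∈ D | toBase p = b})
    (Θ : Spacetime → ℂ) (hΘ : AnalyticOnNhd ℂ Θ D) (hheav : IsHeavenly D Θ)
    (r ρ : ℝ) (hρ : 0 < ρ) (hρr : ρ < r)
    (hM gM hN gN : Base → ℂ) (fM fN : Spacetime × ℂ → ℂ)
    (hfM : IsGenerator D Θ r hM gM fM) (hfN : IsGenerator D Θ r hN gN fN) :
    IsHiddenTower D Θ hM gM (hidden ρ fM) ∧
    IsHiddenTower D Θ hN gN (hidden ρ fN) ∧
    ∃ (hMN gMN : Base → ℂ) (fMN : Spacetime × ℂ → ℂ),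
      IsGenerator D Θ r hMN gMN fMN ∧
      (∀ p ∈ D, residualField hMN gMN p =
        VectorField.lieBracket ℂ (residualField hM gM) (residualField hN gN) p) ∧
      IsHiddenTower D Θ hMN gMN (hidden ρ fMN) ∧
      ∀ i j : ℤ, ∀ p ∈ D,
        hiddenBracket ρ Θ fM fN i j p = hidden ρ fMN (i + j) p := by
  have hMN := hfM.poisson hD hΘ (hρ.trans hρr) hfN
  refine ⟨hfM.isHiddenTower hD hfib hΘ hheav hρ hρr, hfN.isHiddenTower hD hfib hΘ hheav hρ hρr,
    _, _, _, hMN, fun p hp => ?_, hMN.isHiddenTower hD hfib hΘ hheav hρ hρr,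
    fun i j p _ => hiddenBracket_eq_hidden hρ i j p⟩
  have hp' := Set.mem_image_of_mem toBase hp
  exact residualField_basePoisson (hfM.holomorphic_h _ hp') (hfM.holomorphic_g _ hp')
    (hfN.holomorphic_h _ hp') (hfN.holomorphic_g _ hp')
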